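/- Theorem (Nefness Criterion). Let $X$ be a noetherian variety over a field $K$ (a reduced, separated, noetherian scheme locally of finite type over $K$), and let $\mathcal{L}$ be a line bundle on $X$. A closed subvariety of $X$ is a closed subset (possibly empty or reducible) with its reduced induced scheme structure. An irreducible curve in a variety is an integral closed subscheme of dimension one that is proper over $K$ (properness is automatic if the variety is proper over $K$), and $C\cdot\mathcal{L}$ denotes the degree of $\mathcal{L}|_C$. A line bundle $\mathcal{M}$ on a variety $Y$ is called nef if $C\cdot\mathcal{M}\geqslant 0$ for every irreducible curve $C\subset Y$, and it is called nef outside a closed subset $Z\subset Y$ if $C\cdot\mathcal{M}\geqslant 0$ for every irreducible curve $C\subset Y$ with $C\not\subset Z$. Assume that there exists a set $\mathcal{V}$ of closed subvarieties of $X$ satisfying: (i) $\emptyset\in\mathcal{V}$ and $X\in\mathcal{V}$; (ii) for every $Y\in\mathcal{V}$ with $Y\neq\emptyset$, there exist finitely many (possibly no) elements $Z_1,\dots,Z_b\in\mathcal{V}$ with $Z_1,\dots,Z_b\subsetneq Y$ such that the restricted line bundle $\mathcal{L}|_Y$ is nef outside the union $Z_1\cup\cdots\cup Z_b$. Then $\mathcal{L}$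 is nef on $X$. -/

import Mathlib

open CategoryTheory AlgebraicGeometry TopologicalSpace

universe u

namespace NefCriterion

/-! ### Line bundles -/

/-- A section `e` of the `𝒪_X`-module `M` over `U` is a *frame* of `M` over `U` if it freely generates
`M|_U`: over each open `W ⊆ U` every section of `M` is `a • e|_W` for exactly one function `a` on
`W`. In other words, multiplication by `e` is an isomorphism `𝒪_U ≅ M|_U`. -/
def IsFrame {X : Scheme.{u}} (M : X.Modules) (U : X.Opens) (e : Γ(M, U)) : Prop :=
  ∀ (W : X.Opens) (h : W ≤ U),
    Function.Bijective fun a : Γ(X, W) => a • M.presheaf.map (homOfLE h).op e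

/-- A line bundle on `X`: an `𝒪_X`-module which is locally free of rank one. -/
def IsLineBundle {X : Scheme.{u}} (M : X.Modules) : Prop :=
  ∀ x : X, ∃ (U : X.Opens) (_ : x ∈ U) (e : Γ(M, U)), IsFrame M U e

/-! ### Degree of a line bundle on a complete integral curve -/

/-- `IsOrderAt M s x n`: the rational section of the line bundle `M` on the integral scheme `C` given
by the section `s` over the nonempty open set `V` has order `n` at the point `x`. That is, if `e`
is a frame of `M` near `x` and `s = a • e`, then the rational function `a` has order of vanishing
`n` at `x`. (The order is `0` at points which are not of codimension one.) -/
def IsOrderAt {C : Scheme.{u}} [IsIntegral C] [IsLocallyNoetherian C] (M : C.Modules)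
    {V : C.Opens} (s : Γ(M, V)) (x : C) (n : ℤ) : Prop :=
  ∃ (U : C.Opens) (_ : x ∈ U) (e : Γ(M, U)) (_ : IsFrame M U e)
    (_ : Nonempty (U ⊓ V : C.Opens)) (a : Γ(C, U ⊓ V)),
    M.presheaf.map (homOfLE (inf_le_right : U ⊓ V ≤ V)).op s =
      a • M.presheaf.map (homOfLE (inf_le_left : U ⊓ V ≤ U)).op e ∧
    n = C.ord (C.germToFunctionField (U ⊓ V) a) x

/-- `IsDegree p M d`, for a line bundle `M` on an integral curve `p : C ⟶ Spec K` over a field: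
`M` has a nonzero rational section `s` whose divisor has degree
`∑ₓ ordₓ(s) [κ(x) : K] = d`. -/
def IsDegree {K : Type u} [Field K] {C : Scheme.{u}} [IsIntegral C] [IsLocallyNoetherian C]
    (p : C ⟶ Spec (.of K)) (M : C.Modules) (d : ℤ) : Prop :=
  ∃ (V : C.Opens) (s : Γ(M, V)) (_ : s ≠ 0) (D : C → ℤ),
    (∀ x, IsOrderAt M s x (D x)) ∧ d = ∑ᶠ x : C, D x * (p.residueDegree x : ℤ)

/-- The degree of a line bundle `M` on a complete integral curve `p : C ⟶ Spec K`: the degree of the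
divisor of any nonzero rational section of `M` (on a complete curve all choices of the rational
section give the same number). -/
noncomputable def degree {K : Type u} [Field K] {C : Scheme.{u}} [IsIntegral C]
    (p : C ⟶ Spec (.of K)) [IsProper p] (M : C.Modules) : ℤ :=
  haveI : IsLocallyNoetherian C := LocallyOfFiniteType.isLocallyNoetherian p
  open Classical in
  if h : ∃ d : ℤ, IsDegree p M d then h.choose else 0

/-! ### Curves, intersection numbers, nefness -/

/-- An irreducible (complete) curve in the `K`-scheme `f : X ⟶ Spec K`: an integral closed subscheme
of `X` of dimension one which is proper over `K`. If `X` is proper over `K`, then properness of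
the curve is automatic. -/
structure Curve {K : Type u} [Field K] {X : Scheme.{u}} (f : X ⟶ Spec (.of K)) where
  /-- the underlying scheme -/
  scheme : Scheme.{u}
  /-- the inclusion into `X` -/
  ι : scheme ⟶ X
  isClosedImmersion : IsClosedImmersion ι
  isIntegral : IsIntegral scheme
  dim_eq_one : topologicalKrullDim scheme = 1
  isProper : IsProper (ι ≫ f)

attribute [instance] Curve.isClosedImmersion Curve.isIntegral Curve.isProper

/-- The intersection number `C · L`: the degree of `L|_C`. -/
noncomputable def Curve.inter {K : Type u} [Field K] {X : Scheme.{u}} {f : X ⟶ Spec (.of K)}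
    (C : Curve f) (L : X.Modules) : ℤ :=
  degree (C.ι ≫ f) ((Scheme.Modules.pullback C.ι).obj L)

/-- `L` is nef outside the closed subset `Z` of `X`. -/
def IsNefOutside {K : Type u} [Field K] {X : Scheme.{u}} (f : X ⟶ Spec (.of K))
    (L : X.Modules) (Z : Closeds X) : Prop :=
  ∀ C : Curve f, ¬ Set.range C.ι ⊆ (Z : Set X) → 0 ≤ C.inter L

/-- `L` is nef on `X`. -/
def IsNef {K : Type u} [Field K] {X : Scheme.{u}} (f : X ⟶ Spec (.of K))
    (L : X.Modules) : Prop :=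
  ∀ C : Curve f, 0 ≤ C.inter L

/-! ### Closed subvarieties

Closed subvarieties of `X` (possibly empty or reducible) are closed subsets `Y` of `X`, endowed with
the reduced induced scheme structure. -/

/-- The closed subset `Y` as a reduced closed subscheme of `X`. -/
noncomputable abbrev toScheme {X : Scheme.{u}} (Y : Closeds X) : Scheme.{u} :=
  (Scheme.IdealSheafData.vanishingIdeal Y).subscheme

/-- The inclusion `Y ⟶ X` of a closed subvariety. -/
noncomputable abbrev incl {X : Scheme.{u}} (Y : Closeds X) : toScheme Y ⟶ X :=
  (Scheme.IdealSheafData.vanishingIdeal Y).subschemeι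

/-- The restriction `L|_Y`. -/
noncomputable abbrev restrict {X : Scheme.{u}} (L : X.Modules) (Y : Closeds X) :
    (toScheme Y).Modules :=
  (Scheme.Modules.pullback (incl Y)).obj L

end NefCriterion

namespace NefCriterion

/-! Closed subsets of a noetherian space satisfy the descending chain condition, so for a curve `C`
there is a minimal `Y ∈ 𝒱` containing it. If `C` lay in the union of the `Z_i ⊊ Y`, irreducibility
would put it inside one of them, against minimality. Hence nefness of `L|_Y` outside that union
applies to `C`, seen as a curve in `Y`. It remains that the degree is the same in `Y` as in `X`
(`Curve.inter_toSubvariety`), which rests on isomorphism invariance of `degree`. -/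

open Scheme.Modules in
lemma app_presheaf_map {X : Scheme.{u}} {M N : X.Modules} (φ : M ⟶ N) {U V : X.Opens}
    (i : U ⟶ V) (x : Γ(M, V)) :
    φ.app U (M.presheaf.map i.op x) = N.presheaf.map i.op (φ.app V x) :=
  congr($(φ.mapPresheaf.naturality i.op) x)

lemma app_bijective {X : Scheme.{u}} {M N : X.Modules} (φ : M ≅ N) (U : X.Opens) :
    Function.Bijective (φ.hom.app U) :=
  ConcreteCategory.bijective_of_isIso (φ.hom.app U)

lemma IsFrame.map_iso {X : Scheme.{u}} {M N : X.Modules} (φ : M ≅ N) {U : X.Opens}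
    {e : Γ(M, U)} (he : IsFrame M U e) : IsFrame N U (φ.hom.app U e) := by
  intro W h
  convert (app_bijective φ W).comp (he W h) using 1
  funext a
  simp [app_presheaf_map]

lemma IsOrderAt.map_iso {C : Scheme.{u}} [IsIntegral C] [IsLocallyNoetherian C] {M N : C.Modules}
    (φ : M ≅ N) {V : C.Opens} {s : Γ(M, V)} {x : C} {n : ℤ} (h : IsOrderAt M s x n) :
    IsOrderAt N (φ.hom.app V s) x n := by
  obtain ⟨U, hx, e, he, hne, a, ha, hn⟩ := h
  refine ⟨U, hx, φ.hom.app U e, he.map_iso φ, hne, a, ?_, hn⟩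
  rw [← app_presheaf_map, ← app_presheaf_map, ha, Scheme.Modules.Hom.app_smul]

lemma IsDegree.map_iso {K : Type u} [Field K] {C : Scheme.{u}} [IsIntegral C]
    [IsLocallyNoetherian C] {p : C ⟶ Spec (.of K)} {M N : C.Modules} (φ : M ≅ N) {d : ℤ}
    (h : IsDegree p M d) : IsDegree p N d := by
  obtain ⟨V, s, hs, D, hD, hd⟩ := h
  refine ⟨V, φ.hom.app V s, fun h0 => hs ((app_bijective φ V).1 (h0.trans (map_zero _).symm)), D,
    fun x => (hD x).map_iso φ, hd⟩

/-- The degree depends only on the isomorphism class of the line bundle. -/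
lemma degree_congr {K : Type u} [Field K] {C : Scheme.{u}} [IsIntegral C]
    {p q : C ⟶ Spec (.of K)} [IsProper p] [IsProper q] (hpq : p = q) {M N : C.Modules}
    (φ : M ≅ N) : degree p M = degree q N := by
  subst hpq
  have : IsLocallyNoetherian C := LocallyOfFiniteType.isLocallyNoetherian p
  -- `degree` is a choice made from this predicate, so equal predicates give the same chosen value;
  -- uniqueness of the degree is not needed.
  have h : IsDegree p M = IsDegree p N :=
    funext fun d => propext ⟨fun h => h.map_iso φ, fun h => h.map_iso φ.symm⟩
  unfold degree
  have key : ∀ {P Q : ℤ → Prop}, P = Q →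
      (open Classical in if h : ∃ d, P d then h.choose else 0) =
        open Classical in if h : ∃ d, Q d then h.choose else 0 := by
    rintro P _ rfl
    rfl
  exact key h

/-- On a reduced source the zero ideal is the nilradical, i.e. the vanishing ideal of the whole
space; pushing it forward along `g` gives the claim. -/
lemma ker_eq_vanishingIdeal {X Y : Scheme.{u}} [IsReduced X] (g : X ⟶ Y) [QuasiCompact g] :
    g.ker = Scheme.IdealSheafData.vanishingIdeal (.closure (Set.range g)) := by
  have h := Scheme.IdealSheafData.map_vanishingIdeal g ⊤
  rw [Scheme.IdealSheafData.vanishingIdeal_top, Scheme.nilradical_eq_bot,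
    Scheme.IdealSheafData.map_bot] at h
  simpa using h

/-- A morphism from a reduced scheme whose image lies in `Y` has kernel containing the ideal
of `Y`. -/
lemma ker_incl_le {X T : Scheme.{u}} [IsReduced T] (g : T ⟶ X) [QuasiCompact g] {Y : Closeds X}
    (h : Set.range g ⊆ Y) : (incl Y).ker ≤ g.ker := by
  rw [Scheme.IdealSheafData.ker_subschemeι, ker_eq_vanishingIdeal]
  exact Scheme.IdealSheafData.vanishingIdeal_antimono (Closeds.closure_le.2 h)

section Restriction

variable {K : Type u} [Field K] {X : Scheme.{u}} {f : X ⟶ Spec (.of K)}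

/-- A curve in `X` contained in the closed subvariety `Y`, as a curve in `Y`. -/
noncomputable abbrev Curve.toSubvariety (C : Curve f) (Y : Closeds X) (h : Set.range C.ι ⊆ Y) :
    Curve (incl Y ≫ f) where
  scheme := C.scheme
  ι := IsClosedImmersion.lift (incl Y) C.ι (ker_incl_le C.ι h)
  isClosedImmersion := by
    have : IsClosedImmersion (IsClosedImmersion.lift (incl Y) C.ι (ker_incl_le C.ι h) ≫ incl Y) := by
      rw [IsClosedImmersion.lift_fac]; infer_instance
    exact IsClosedImmersion.of_comp_isClosedImmersion _ (incl Y)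
  isIntegral := C.isIntegral
  dim_eq_one := C.dim_eq_one
  isProper := by
    rw [← Category.assoc, IsClosedImmersion.lift_fac]; infer_instance

lemma Curve.toSubvariety_ι_incl (C : Curve f) (Y : Closeds X) (h : Set.range C.ι ⊆ Y) :
    (C.toSubvariety Y h).ι ≫ incl Y = C.ι :=
  IsClosedImmersion.lift_fac _ _ _

/-- Restricting in two stages agrees with restricting directly only up to canonical isomorphism,
hence the appeal to `degree_congr`. -/
lemma Curve.inter_toSubvariety (C : Curve f) (Y : Closeds X) (h : Set.range C.ι ⊆ Y)
    (L : X.Modules) : (C.toSubvariety Y h).inter (restrict L Y) = C.inter L :=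
  haveI : IsProper ((C.toSubvariety Y h).ι ≫ incl Y ≫ f) := (C.toSubvariety Y h).isProper
  degree_congr (C := C.scheme) (by rw [← Category.assoc]; congr 1; exact C.toSubvariety_ι_incl Y h)
    ((Scheme.Modules.pullbackComp (C.toSubvariety Y h).ι (incl Y)).app L ≪≫
      (Scheme.Modules.pullbackCongr (C.toSubvariety_ι_incl Y h)).app L)

lemma Curve.range_toSubvariety_subset_iff (C : Curve f) (Y : Closeds X)
    (h : Set.range C.ι ⊆ Y) (Z : Closeds X) :
    Set.range (C.toSubvariety Y h).ι ⊆ (Z.preimage (incl Y).continuous : Set (toScheme Y)) ↔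
      Set.range C.ι ⊆ Z := by
  conv_rhs => rw [← C.toSubvariety_ι_incl Y h]
  simp only [Set.range_subset_iff, Scheme.Hom.comp_apply]
  rfl

lemma Curve.isIrreducible_range (C : Curve f) : IsIrreducible (Set.range C.ι) := by
  rw [← Set.image_univ]
  exact (IrreducibleSpace.isIrreducible_univ C.scheme).image _ C.ι.continuous.continuousOn

end Restriction

lemma exists_subset_of_subset_finset_sup {α : Type*} [TopologicalSpace α] {s : Set α}
    (hs : IsIrreducible s) (𝒵 : Finset (Closeds α)) (h : s ⊆ (𝒵.sup id : Closeds α)) :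
    ∃ Z ∈ 𝒵, s ⊆ (Z : Set α) := by
  classical
  induction 𝒵 using Finset.induction_on with
  | empty => exact absurd (h hs.nonempty.choose_spec) (by simp)
  | insert Z 𝒵 _ ih =>
    rw [Finset.sup_insert, id, Closeds.coe_sup] at h
    rcases isPreirreducible_iff_isClosed_union_isClosed.1 hs.2 _ _ Z.isClosed
      (𝒵.sup id).isClosed h with h | h
    · exact ⟨Z, by simp, h⟩
    · obtain ⟨W, hW, hsW⟩ := ih h
      exact ⟨W, by simp [hW], hsW⟩

end NefCriterion

theorem mainTheorem9 {K : Type u} [Field K] (X : Scheme.{u}) (f : X ⟶ Spec (.of K))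
    [IsNoetherian X] [IsReduced X] [IsSeparated f] [LocallyOfFiniteType f]
    (L : X.Modules) (hL : NefCriterion.IsLineBundle L)
    (𝒱 : Set (Closeds X)) (h_empty : ⊥ ∈ 𝒱) (h_univ : ⊤ ∈ 𝒱)
    (h_nef : ∀ Y ∈ 𝒱, Y ≠ ⊥ → ∃ 𝒵 : Finset (Closeds X),
      (∀ Z ∈ 𝒵, Z ∈ 𝒱 ∧ Z < Y) ∧
      NefCriterion.IsNefOutside (NefCriterion.incl Y ≫ f) (NefCriterion.restrict L Y)
        ((𝒵.sup id).preimage (NefCriterion.incl Y).continuous)) :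
    NefCriterion.IsNef f L := by
  intro C
  -- Noetherianity of `X` enters here, as well-foundedness of `<` on `Closeds X`.
  obtain ⟨Y, ⟨hY, hCY⟩, hmin⟩ := wellFounded_lt.has_min
    {Y : Closeds X | Y ∈ 𝒱 ∧ Set.range C.ι ⊆ Y} ⟨⊤, h_univ, by simp⟩
  have hne : Y ≠ ⊥ := by
    rintro rfl
    exact absurd (hCY C.isIrreducible_range.nonempty.choose_spec) (by simp)
  obtain ⟨𝒵, h𝒵, hnef⟩ := h_nef Y hY hne
  rw [← C.inter_toSubvariety Y hCY L]
  refine hnef (C.toSubvariety Y hCY) fun hsub => ?_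
  rw [C.range_toSubvariety_subset_iff] at hsub
  obtain ⟨Z, hZ, hCZ⟩ :=
    NefCriterion.exists_subset_of_subset_finset_sup C.isIrreducible_range 𝒵 hsub
  exact hmin Z ⟨(h𝒵 Z hZ).1, hCZ⟩ (h𝒵 Z hZ).2
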